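/- Let $n\ge 1$ and consider $n$ balls numbered $1,\dots,n$ that are placed one after the other, in the order $1,2,\dots,n$, into $n$ pits numbered $1,\dots,n$, each pit holding one ball. Ball $1$ is placed in a pit chosen uniformly at random among all $n$ pits. For $i=2,\dots,n$, ball $i$ is placed in pit $i$ if that pit is still empty; otherwise it is placed in a pit chosen uniformly at random (given the previous placements) among the $n-i+1$ pits that are still empty. Let $W_n$ be the number of $i\in\{1,\dots,n\}$ such that ball $i$ is not placed in pit $i$. Then, as $n\to\infty$, $$\frac{W_n-\log n}{\sqrt{\log n}}$$ converges in distribution to the standard normal distribution $N(0,1)$. -/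

import Mathlib

open MeasureTheory ProbabilityTheory Filter

noncomputable section

namespace BallsInPits

/-- The pits that are still empty after the balls `0, …, i - 1` have been placed, where ball `j`
lies in pit `N j`. Balls and pits are numbered from `0` to `n - 1`. -/
def emptyPits {n i : ℕ} (N : Fin i → Fin n) : Finset (Fin n) :=
  Finset.univ \ Finset.univ.image N

theorem emptyPits_nonempty {n i : ℕ} (hi : i < n) (N : Fin i → Fin n) :
    (emptyPits N).Nonempty := by
  by_contra h
  rw [Finset.not_nonempty_iff_eq_empty, emptyPits, Finset.sdiff_eq_empty_iff_subset] at h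
  have h1 := Finset.card_le_card h
  have h2 := Finset.card_image_le (s := (Finset.univ : Finset (Fin i))) (f := N)
  simp only [Finset.card_univ, Fintype.card_fin] at h1 h2
  omega

/-- The law of the pit taken by ball `i`, given that the balls `0, …, i - 1` lie in the pits
`N 0, …, N (i - 1)`. Every ball but the first one takes its assigned pit if that pit is empty;
otherwise, and always for the first ball, the pit is uniformly random among the empty pits. -/
def nextPit {n i : ℕ} (hi : i < n) (N : Fin i → Fin n) : PMF (Fin n) :=
  if i ≠ 0 ∧ (⟨i, hi⟩ : Fin n) ∈ emptyPits N then PMF.pure ⟨i, hi⟩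
  else PMF.uniformOfFinset (emptyPits N) (emptyPits_nonempty hi N)

/-- The joint law of the pits taken by the first `i` balls: the balls are placed one after the
other, each according to `nextPit`. -/
def firstPlacements (n : ℕ) : (i : ℕ) → i ≤ n → PMF (Fin i → Fin n)
  | 0, _ => PMF.pure Fin.elim0
  | i + 1, hi =>
      (firstPlacements n i (Nat.le_of_succ_le hi)).bind fun N =>
        (nextPit (Nat.lt_of_succ_le hi) N).map fun p => (Fin.snoc N p : Fin (i + 1) → Fin n)

/-- The law of the random placement of all `n` balls: the value at `j` is the pit of ball `j`. -/
def placementLaw (n : ℕ) : PMF (Fin n → Fin n) := firstPlacements n n le_rfl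

/-- The number of balls that do not meet their assigned pit. -/
def misplaced {n : ℕ} (N : Fin n → Fin n) : ℕ :=
  (Finset.univ.filter fun j => N j ≠ j).card

end BallsInPits

end

open scoped Topology

namespace BallsInPits

/-! The generating function of the number of misplaced balls is computed exactly. Once the first
ball is placed, at most one occupied pit `p` has its ball still to come. When ball `p` arrives it
takes pit 0, which ends the disorder, or some pit `q > p`, which takes over the role of `p`. The
resulting recursion telescopes, so `placementValue` is a martingale (`pmfMean_nextPit`), and `E z ^
W = (1 - z) / n + z * ∏ (1 + (z - 1) / m)` over `2 ≤ m ≤ n` (`pmfMean_pow_misplaced`). Up to the `1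
/ n` term this is the law of `1` plus independent Bernoulli(`1 / m`) variables. With `z = exp (i t /
√(log n))` the product is close to `exp ((z - 1) log n)`; after centring, a second-order expansion
gives `exp (-t² / 2)`, and Lévy's continuity theorem concludes. -/

/-- The expectation of `f` under a probability mass function on a finite type. -/
noncomputable def pmfMean {α : Type*} [Fintype α] (p : PMF α) (f : α → ℂ) : ℂ :=
  ∑ a, ((p a).toReal : ℂ) * f a

section pmfMean

variable {α β : Type*} [Fintype α] [Fintype β]

theorem pmfMean_pure (a : α) (f : α → ℂ) : pmfMean (PMF.pure a) f = f a := by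
  classical
  unfold pmfMean
  rw [Finset.sum_eq_single a]
  · simp
  · intro b _ hb
    simp [PMF.pure_apply, hb]
  · simp

theorem pmfMean_bind (p : PMF α) (q : α → PMF β) (f : β → ℂ) :
    pmfMean (p.bind q) f = pmfMean p fun a => pmfMean (q a) f := by
  have h (b : β) : ((p.bind q) b).toReal = ∑ a, (p a).toReal * (q a b).toReal := by
    rw [PMF.bind_apply, tsum_fintype, ENNReal.toReal_sum]
    · simp
    · exact fun a _ => ENNReal.mul_ne_top (p.apply_ne_top a) ((q a).apply_ne_top b)
  simp only [pmfMean, h, Complex.ofReal_sum, Complex.ofReal_mul, Finset.sum_mul, Finset.mul_sum]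
  rw [Finset.sum_comm]
  simp only [mul_assoc]

theorem pmfMean_map (p : PMF α) (g : α → β) (f : β → ℂ) :
    pmfMean (p.map g) f = pmfMean p fun a => f (g a) := by
  simp only [PMF.map, pmfMean_bind, Function.comp_apply, pmfMean_pure]

theorem pmfMean_uniformOfFinset (s : Finset α) (hs : s.Nonempty) (f : α → ℂ) :
    pmfMean (PMF.uniformOfFinset s hs) f = (s.card : ℂ)⁻¹ * ∑ a ∈ s, f a := by
  classical
  simp only [pmfMean, PMF.uniformOfFinset_apply, Finset.mul_sum]
  rw [← Finset.sum_subset (Finset.subset_univ s)]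
  · exact Finset.sum_congr rfl fun a ha => by simp [ha]
  · intro a _ ha
    simp [ha]

theorem pmfMean_congr (p : PMF α) {f g : α → ℂ} (h : ∀ a ∈ p.support, f a = g a) :
    pmfMean p f = pmfMean p g := by
  refine Finset.sum_congr rfl fun a _ => ?_
  by_cases ha : a ∈ p.support
  · rw [h a ha]
  · simp [(PMF.apply_eq_zero_iff p a).2 ha]

end pmfMean

/-! ### Invariants of the placement process -/

theorem emptyPits_snoc {n i : ℕ} (N : Fin i → Fin n) (p : Fin n) :
    emptyPits (Fin.snoc N p : Fin (i + 1) → Fin n) = (emptyPits N).erase p := by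
  ext q
  simp only [emptyPits, Finset.mem_sdiff, Finset.mem_univ, true_and, Finset.mem_image,
    Finset.mem_erase, Fin.exists_fin_succ', Fin.snoc_castSucc, Fin.snoc_last, not_or]
  tauto

/-- The invariant of the placement process: after `i` balls there are `n - i` empty pits, and
the pits below `i` are all occupied, except possibly pit `0`. -/
def IsReachable {n i : ℕ} (N : Fin i → Fin n) : Prop :=
  (emptyPits N).card = n - i ∧ ∀ p ∈ emptyPits N, (p : ℕ) = 0 ∨ i ≤ p

theorem IsReachable.snoc {n i : ℕ} (hi : i < n) {N : Fin i → Fin n} (hN : IsReachable N)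
    {p : Fin n} (hp : p ∈ (nextPit hi N).support) :
    IsReachable (Fin.snoc N p : Fin (i + 1) → Fin n) := by
  have hp' : p ∈ emptyPits N ∧ (i ≠ 0 → (⟨i, hi⟩ : Fin n) ∈ emptyPits N → p = ⟨i, hi⟩) := by
    unfold nextPit at hp
    split_ifs at hp with h
    · rw [PMF.support_pure, Set.mem_singleton_iff] at hp
      subst hp
      exact ⟨h.2, fun _ _ => rfl⟩
    · rw [PMF.mem_support_uniformOfFinset_iff] at hp
      exact ⟨hp, fun h0 h1 => absurd ⟨h0, h1⟩ h⟩
  refine ⟨?_, fun q hq => ?_⟩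
  · rw [emptyPits_snoc, Finset.card_erase_of_mem hp'.1, hN.1]
    omega
  · rw [emptyPits_snoc, Finset.mem_erase] at hq
    rcases hN.2 q hq.2 with h | h
    · exact Or.inl h
    · by_cases hqi : (q : ℕ) = i
      · have hq' : q = ⟨i, hi⟩ := Fin.ext hqi
        by_cases h0 : i = 0
        · omega
        · exact absurd (hq'.trans (hp'.2 h0 (hq' ▸ hq.2)).symm) hq.1
      · omega

theorem isReachable_of_mem_support {n : ℕ} : ∀ (i : ℕ) (hi : i ≤ n) (N : Fin i → Fin n),
    N ∈ (firstPlacements n i hi).support → IsReachable N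
  | 0, _, N, _ => by simp [IsReachable, emptyPits]
  | i + 1, hi, N, hN => by
      rw [firstPlacements, PMF.mem_support_bind_iff] at hN
      obtain ⟨M, hM, hN⟩ := hN
      rw [PMF.mem_support_map_iff] at hN
      obtain ⟨p, hp, rfl⟩ := hN
      exact (isReachable_of_mem_support i _ M hM).snoc _ hp

/-- The number of the first `i` balls that do not meet their assigned pit. -/
def misplacedFirst {n i : ℕ} (N : Fin i → Fin n) : ℕ :=
  (Finset.univ.filter fun j : Fin i => (N j : ℕ) ≠ j).card

theorem misplacedFirst_snoc {n i : ℕ} (N : Fin i → Fin n) (p : Fin n) :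
    misplacedFirst (Fin.snoc N p : Fin (i + 1) → Fin n) =
      misplacedFirst N + if (p : ℕ) = i then 0 else 1 := by
  simp [misplacedFirst, Finset.card_filter, Fin.sum_univ_castSucc, -Finset.sum_boole]

theorem misplacedFirst_eq_misplaced {n : ℕ} (N : Fin n → Fin n) :
    misplacedFirst N = misplaced N := by
  simp [misplacedFirst, misplaced, ne_eq, Fin.ext_iff]

/-! ### The exact generating function -/

/-- The product `∏ (1 + z / m)` over `1 ≤ m ≤ k`. -/
noncomputable def risingProd (z : ℂ) (k : ℕ) : ℂ := ∏ j ∈ Finset.range k, (1 + z / (j + 1))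

/-- The expectation of `z` to the number of balls misplaced from now on, when `p` is the
only occupied pit whose ball is still to come. -/
noncomputable def pitWeight (z : ℂ) {n : ℕ} (p : Fin n) : ℂ :=
  risingProd z (n - p) - risingProd z (n - p - 1)

theorem pitWeight_eq (z : ℂ) {n : ℕ} (p : Fin n) :
    pitWeight z p = z / (n - p : ℕ) * risingProd z (n - p - 1) := by
  obtain ⟨d, hd⟩ : ∃ d, n - (p : ℕ) = d + 1 := ⟨n - p - 1, by omega⟩
  rw [pitWeight, hd, Nat.add_sub_cancel, risingProd, Finset.prod_range_succ, ← risingProd]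
  push_cast
  ring

/-- The weights are consecutive differences of `risingProd`, so the sum telescopes. -/
theorem sum_pitWeight_gt (z : ℂ) {n i : ℕ} (hi : i < n) :
    ∑ p ∈ (Finset.univ.filter fun p : Fin n => i < (p : ℕ)), pitWeight z p =
      risingProd z (n - i - 1) - 1 := by
  have h (d : ℕ) (hd : d ≤ n) : ∑ k ∈ Finset.Ico (n - d) n,
      (risingProd z (n - k) - risingProd z (n - k - 1)) = risingProd z d - 1 := by
    induction d with
    | zero => simp [risingProd]
    | succ d ih =>
      rw [Finset.sum_eq_sum_Ico_succ_bot (by omega), show n - (d + 1) + 1 = n - d by omega,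
        ih (by omega), show n - (n - (d + 1)) = d + 1 by omega, Nat.add_sub_cancel]
      ring
  simp only [pitWeight]
  rw [← h (n - i - 1) (by omega), Finset.sum_filter,
    Fin.sum_univ_eq_sum_range
      (fun k => if i < k then risingProd z (n - k) - risingProd z (n - k - 1) else 0) n,
    ← Finset.sum_filter]
  refine Finset.sum_congr ?_ fun _ _ => rfl
  ext k
  simp only [Finset.mem_filter, Finset.mem_range, Finset.mem_Ico]
  omega

/-- The conditional expectation of `z` to the total number of misplaced balls, given the placement
`N` of the first `i ≥ 1` balls. -/
noncomputable def placementValue (z : ℂ) {n i : ℕ} (N : Fin i → Fin n) : ℂ :=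
  z ^ misplacedFirst N *
    ∏ p ∈ (Finset.univ.filter fun p : Fin n => i ≤ (p : ℕ) ∧ p ∉ emptyPits N), pitWeight z p

theorem pmfMean_nextPit (z : ℂ) {n i : ℕ} (h0 : i ≠ 0) (hi : i < n) {N : Fin i → Fin n}
    (hN : IsReachable N) :
    pmfMean (nextPit hi N) (fun p => placementValue z (Fin.snoc N p : Fin (i + 1) → Fin n)) =
      placementValue z N := by
  by_cases hE : (⟨i, hi⟩ : Fin n) ∈ emptyPits N
  · rw [nextPit, if_pos ⟨h0, hE⟩, pmfMean_pure, placementValue, placementValue, misplacedFirst_snoc,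
      emptyPits_snoc]
    simp only [if_true, add_zero]
    congr 2
    ext p
    simp only [Finset.mem_filter, Finset.mem_univ, true_and, Finset.mem_erase, not_and, ne_eq, Fin.ext_iff]
    constructor
    · rintro ⟨h1, h2⟩
      exact ⟨by omega, h2 (by omega)⟩
    · rintro ⟨h1, h2⟩
      have : (p : ℕ) ≠ i := fun h => h2 ((Fin.ext h : p = ⟨i, hi⟩) ▸ hE)
      exact ⟨by omega, fun _ => h2⟩
  · have hz : 0 < n := by omega
    -- Only pit 0 and the pits above `i` can be empty. There are exactly `n - i` of these, as many
    -- as there are empty pits, so all of them are empty.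
    have hEq : emptyPits N = insert ⟨0, hz⟩ (Finset.univ.filter fun p : Fin n => i < (p : ℕ)) := by
      apply Finset.eq_of_subset_of_card_le
      · intro p hp
        have hpi : (p : ℕ) ≠ i := fun h => hE ((Fin.ext h : p = ⟨i, hi⟩) ▸ hp)
        have := hN.2 p hp
        simp only [Finset.mem_insert, Finset.mem_filter, Finset.mem_univ, true_and, Fin.ext_iff]
        omega
      · have hc : (Finset.univ.filter fun p : Fin n => i < (p : ℕ)) = Finset.Ioi ⟨i, hi⟩ := by
          ext p
          simp [Fin.lt_def]
        rw [hN.1, Finset.card_insert_of_notMem (by simp), hc, Fin.card_Ioi]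
        simp only
        omega
    have hocc : (Finset.univ.filter fun p : Fin n => i ≤ (p : ℕ) ∧ p ∉ emptyPits N) = {⟨i, hi⟩} := by
      ext p
      simp only [hEq, Finset.mem_filter, Finset.mem_univ, true_and, Finset.mem_insert,
        Finset.mem_singleton, Fin.ext_iff]
      omega
    rw [nextPit, if_neg (fun h => hE h.2), pmfMean_uniformOfFinset, hN.1, placementValue, hocc,
      Finset.prod_singleton, pitWeight_eq, hEq, Finset.sum_insert (by simp)]
    have hv0 : placementValue z (Fin.snoc N ⟨0, hz⟩ : Fin (i + 1) → Fin n) =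
        z ^ (misplacedFirst N + 1) := by
      rw [placementValue, misplacedFirst_snoc, if_neg (by simpa using h0.symm),
        Finset.prod_eq_one, mul_one]
      intro p hp
      simp only [Finset.mem_filter, Finset.mem_univ, true_and, emptyPits_snoc, hEq,
        Finset.mem_erase, Finset.mem_insert, ne_eq, Fin.ext_iff] at hp
      omega
    have hv (q : Fin n) (hq : i < q) : placementValue z (Fin.snoc N q : Fin (i + 1) → Fin n) =
        z ^ (misplacedFirst N + 1) * pitWeight z q := by
      rw [placementValue, misplacedFirst_snoc, if_neg (by omega)]
      congr 1
      rw [← Finset.prod_singleton (pitWeight z) q]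
      refine Finset.prod_congr ?_ fun _ _ => rfl
      ext p
      simp only [Finset.mem_filter, Finset.mem_univ, true_and, emptyPits_snoc, hEq,
        Finset.mem_erase, Finset.mem_insert, Finset.mem_singleton, ne_eq, Fin.ext_iff]
      omega
    rw [hv0, Finset.sum_congr rfl fun q hq => hv q (Finset.mem_filter.1 hq).2, ← Finset.mul_sum,
      sum_pitWeight_gt z hi]
    simp only [pow_succ]
    ring

theorem pmfMean_placementValue_succ (z : ℂ) {n i : ℕ} (h0 : i ≠ 0) (hi : i + 1 ≤ n) :
    pmfMean (firstPlacements n (i + 1) hi) (placementValue z) =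
      pmfMean (firstPlacements n i (Nat.le_of_succ_le hi)) (placementValue z) := by
  rw [firstPlacements, pmfMean_bind]
  refine pmfMean_congr _ fun N hN => ?_
  rw [pmfMean_map]
  exact pmfMean_nextPit z h0 hi (isReachable_of_mem_support _ _ N hN)

theorem pmfMean_placementValue_one (z : ℂ) {n : ℕ} (hn : 1 ≤ n) :
    pmfMean (firstPlacements n 1 hn) (placementValue z) =
      (n : ℂ)⁻¹ * (1 + z * (risingProd z (n - 1) - 1)) := by
  have hz : 0 < n := hn
  have hE (N : Fin 0 → Fin n) : emptyPits N = Finset.univ := by simp [emptyPits]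
  have hu : (Finset.univ : Finset (Fin n)) =
      insert ⟨0, hz⟩ (Finset.univ.filter fun p : Fin n => 0 < (p : ℕ)) := by
    ext p
    simp only [Finset.mem_univ, Finset.mem_insert, Finset.mem_filter, true_and, true_iff, Fin.ext_iff]
    omega
  have hv0 (N : Fin 0 → Fin n) :
      placementValue z (Fin.snoc N ⟨0, hz⟩ : Fin (0 + 1) → Fin n) = 1 := by
    rw [placementValue, misplacedFirst_snoc, Finset.prod_eq_one]
    · simp [misplacedFirst]
    · intro p hp
      simp only [Finset.mem_filter, Finset.mem_univ, true_and, emptyPits_snoc, hE,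
        Finset.mem_erase, and_true, ne_eq, Fin.ext_iff] at hp
      omega
  have hv (N : Fin 0 → Fin n) (q : Fin n) (hq : 0 < (q : ℕ)) :
      placementValue z (Fin.snoc N q : Fin (0 + 1) → Fin n) = z * pitWeight z q := by
    rw [placementValue, misplacedFirst_snoc, if_neg (by omega)]
    congr 1
    · simp [misplacedFirst]
    rw [← Finset.prod_singleton (pitWeight z) q]
    refine Finset.prod_congr ?_ fun _ _ => rfl
    ext p
    simp only [Finset.mem_filter, Finset.mem_univ, true_and, emptyPits_snoc, hE,
      Finset.mem_erase, Finset.mem_singleton, and_true, ne_eq, Fin.ext_iff]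
    omega
  simp only [firstPlacements, PMF.pure_bind, pmfMean_map, nextPit, ne_eq, not_true_eq_false,
    false_and, if_false, pmfMean_uniformOfFinset, hE, Finset.card_univ, Fintype.card_fin]
  rw [hu, Finset.sum_insert (by simp), hv0,
    Finset.sum_congr rfl fun q hq => hv _ q (Finset.mem_filter.1 hq).2, ← Finset.mul_sum,
    sum_pitWeight_gt z hz, Nat.sub_zero]

theorem pmfMean_placementLaw (z : ℂ) {n : ℕ} (hn : 1 ≤ n) :
    pmfMean (placementLaw n) (fun N => z ^ misplaced N) =
      (n : ℂ)⁻¹ * (1 + z * (risingProd z (n - 1) - 1)) := by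
  have h (i : ℕ) (h1 : 1 ≤ i) (hi : i ≤ n) :
      pmfMean (firstPlacements n i hi) (placementValue z) =
        (n : ℂ)⁻¹ * (1 + z * (risingProd z (n - 1) - 1)) := by
    -- The induction starts at 1: the first ball is placed at random although its own pit is empty,
    -- so the martingale step fails at 0.
    induction i, h1 using Nat.le_induction with
    | base => exact pmfMean_placementValue_one z hn
    | succ i h1 ih => rw [pmfMean_placementValue_succ z (by omega), ih]
  rw [← h n hn le_rfl, placementLaw]
  congr 1
  ext N
  rw [placementValue, misplacedFirst_eq_misplaced, Finset.prod_eq_one, mul_one]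
  intro p hp
  have := (Finset.mem_filter.1 hp).2.1
  omega

/-- Since `1 + z / m = ((m + 1) / m) * (1 + (z - 1) / (m + 1))`, the first factors telescope to `k +
1`. -/
theorem risingProd_eq (z : ℂ) (k : ℕ) :
    risingProd z k = (k + 1) * ∏ j ∈ Finset.range k, (1 + (z - 1) / (j + 2)) := by
  induction k with
  | zero => simp [risingProd]
  | succ k ih =>
    rw [risingProd, Finset.prod_range_succ, ← risingProd, ih, Finset.prod_range_succ]
    have h1 : (k + 1 : ℂ) ≠ 0 := by exact_mod_cast k.succ_ne_zero
    have h2 : (k + 2 : ℂ) ≠ 0 := by exact_mod_cast (k + 1).succ_ne_zero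
    push_cast
    field_simp
    ring

/-- The probability generating function of the number of misplaced balls. -/
theorem pmfMean_pow_misplaced (z : ℂ) {n : ℕ} (hn : 1 ≤ n) :
    pmfMean (placementLaw n) (fun N => z ^ misplaced N) =
      (1 - z) / n + z * ∏ j ∈ Finset.range (n - 1), (1 + (z - 1) / (j + 2)) := by
  obtain ⟨m, rfl⟩ : ∃ m, n = m + 1 := ⟨n - 1, by omega⟩
  rw [pmfMean_placementLaw z hn, risingProd_eq, Nat.add_sub_cancel]
  have h1 : (m + 1 : ℂ) ≠ 0 := by exact_mod_cast m.succ_ne_zero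
  push_cast
  field_simp
  ring

/-! ### Asymptotics of the characteristic function -/

theorem norm_log_one_add_sub_self_le_sq {x : ℂ} (hx : ‖x‖ ≤ 1 / 2) :
    ‖Complex.log (1 + x) - x‖ ≤ ‖x‖ ^ 2 := by
  refine (Complex.norm_log_one_add_sub_self_le (by linarith)).trans ?_
  have h : (1 - ‖x‖)⁻¹ ≤ 2 := by
    rw [inv_le_comm₀ (by linarith) two_pos]
    linarith
  nlinarith [sq_nonneg ‖x‖]

theorem exists_prod_one_add_div_eq_exp {w : ℂ} (hw : ‖w‖ ≤ 1) (k : ℕ) :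
    ∃ r : ℂ, ‖r‖ ≤ ‖w‖ ^ 2 ∧ ∏ j ∈ Finset.range k, (1 + w / (j + 2)) =
      Complex.exp (w * ((harmonic (k + 1) : ℝ) - 1 : ℝ) + r) := by
  -- The sharper bound makes the induction close, as `1 / (k + 2)² ≤ 1 / (k + 1) - 1 / (k + 2)`.
  suffices h : ∃ r : ℂ, ‖r‖ ≤ ‖w‖ ^ 2 * (1 - 1 / (k + 1)) ∧
      ∏ j ∈ Finset.range k, (1 + w / (j + 2)) =
        Complex.exp (w * ((harmonic (k + 1) : ℝ) - 1 : ℝ) + r) by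
    obtain ⟨r, hr, h⟩ := h
    refine ⟨r, hr.trans (mul_le_of_le_one_right (sq_nonneg _) ?_), h⟩
    have : (0 : ℝ) ≤ 1 / (k + 1) := by positivity
    linarith
  induction k with
  | zero => exact ⟨0, by simp, by simp⟩
  | succ k ih =>
    obtain ⟨r, hr, h⟩ := ih
    set x : ℂ := w / (k + 2) with hx
    have hk : ‖(k + 2 : ℂ)‖ = k + 2 := by
      have := Complex.norm_natCast (k + 2)
      push_cast at this
      exact this
    have hnx : ‖x‖ = ‖w‖ / (k + 2) := by rw [hx, norm_div, hk]
    have hk0 : (0 : ℝ) ≤ k := k.cast_nonneg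
    have hx2 : ‖x‖ ≤ 1 / 2 := by
      rw [hnx]
      exact div_le_div₀ zero_le_one hw two_pos (by linarith)
    have hx0 : 1 + x ≠ 0 := by
      intro h0
      have : ‖x‖ = 1 := by rw [(eq_neg_of_add_eq_zero_right h0), norm_neg, norm_one]
      linarith
    refine ⟨r + (Complex.log (1 + x) - x), ?_, ?_⟩
    · refine (norm_add_le _ _).trans ((add_le_add hr (norm_log_one_add_sub_self_le_sq hx2)).trans ?_)
      rw [hnx, div_pow, ← mul_one_div (‖w‖ ^ 2), ← mul_add]
      refine mul_le_mul_of_nonneg_left ?_ (sq_nonneg _)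
      have h3 : (1 : ℝ) / (k + 2) ^ 2 ≤ 1 / ((k + 1) * (k + 2)) :=
        one_div_le_one_div_of_le (by positivity) (by nlinarith)
      have h4 : (1 : ℝ) / ((k + 1) * (k + 2)) = 1 / (k + 1) - 1 / (k + 2) := by
        field_simp
        ring
      have h5 : ((k + 1 : ℕ) : ℝ) + 1 = k + 2 := by
        push_cast
        ring
      rw [h5]
      linarith
    · rw [Finset.prod_range_succ, h]
      conv_lhs => rw [← Complex.exp_log hx0, ← Complex.exp_add]
      congr 1
      rw [harmonic_succ (k + 1), hx]
      push_cast
      ring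

theorem norm_exp_mul_I_sub_le (s : ℝ) :
    ‖Complex.exp (s * Complex.I) - 1 - s * Complex.I + s ^ 2 / 2‖ ≤ |s| ^ 3 * Real.exp |s| := by
  have h := Complex.norm_exp_sub_sum_le_norm_mul_exp (s * Complex.I) 3
  have hs : ‖(s * Complex.I : ℂ)‖ = |s| := by simp
  rw [hs] at h
  convert! h using 2
  simp only [Finset.sum_range_succ, Finset.sum_range_zero, Nat.factorial, mul_pow, Complex.I_sq]
  push_cast
  ring

theorem norm_exp_mul_I_sub_one_le (s : ℝ) : ‖Complex.exp (s * Complex.I) - 1‖ ≤ |s| := by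
  rw [mul_comm]
  exact Real.norm_exp_I_mul_ofReal_sub_one_le

theorem tendsto_exp_mul_prod_exp (t : ℝ) :
    Tendsto (fun n : ℕ => Complex.exp (-((t / √(Real.log n) * Real.log n : ℝ) * Complex.I)) *
      ((1 - Complex.exp ((t / √(Real.log n) : ℝ) * Complex.I)) / n +
        Complex.exp ((t / √(Real.log n) : ℝ) * Complex.I) * ∏ j ∈ Finset.range (n - 1),
          (1 + (Complex.exp ((t / √(Real.log n) : ℝ) * Complex.I) - 1) / (j + 2))))
      atTop (𝓝 (Complex.exp (-(t ^ 2 / 2)))) := by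
  have hL : Tendsto (fun n : ℕ => Real.log n) atTop atTop :=
    Real.tendsto_log_atTop.comp tendsto_natCast_atTop_atTop
  have hs : Tendsto (fun n : ℕ => t / √(Real.log n)) atTop (𝓝 0) :=
    tendsto_const_nhds.div_atTop (Real.tendsto_sqrt_atTop.comp hL)
  have hs' : Tendsto (fun n : ℕ => |t / √(Real.log n)|) atTop (𝓝 0) := by simpa using hs.abs
  have hz : Tendsto (fun n : ℕ => Complex.exp ((t / √(Real.log n) : ℝ) * Complex.I)) atTop
      (𝓝 1) := by
    have hc : Continuous fun s : ℝ => Complex.exp (s * Complex.I) := by fun_prop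
    simpa [Function.comp_def] using (hc.tendsto 0).comp hs
  have hw : Tendsto (fun n : ℕ => Complex.exp ((t / √(Real.log n) : ℝ) * Complex.I) - 1) atTop
      (𝓝 0) := by simpa using hz.sub_const 1
  have hw1 : ∀ᶠ n : ℕ in atTop,
      ‖Complex.exp ((t / √(Real.log n) : ℝ) * Complex.I) - 1‖ ≤ 1 :=
    (hs'.eventually_le_const one_pos).mono fun n hn => (norm_exp_mul_I_sub_one_le _).trans hn
  have hr : ∀ n : ℕ, ∃ r : ℂ, ‖Complex.exp ((t / √(Real.log n) : ℝ) * Complex.I) - 1‖ ≤ 1 →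
      ‖r‖ ≤ ‖Complex.exp ((t / √(Real.log n) : ℝ) * Complex.I) - 1‖ ^ 2 ∧
      ∏ j ∈ Finset.range (n - 1),
        (1 + (Complex.exp ((t / √(Real.log n) : ℝ) * Complex.I) - 1) / (j + 2)) =
        Complex.exp ((Complex.exp ((t / √(Real.log n) : ℝ) * Complex.I) - 1) *
          ((harmonic (n - 1 + 1) : ℝ) - 1 : ℝ) + r) := fun n => by
    by_cases h : ‖Complex.exp ((t / √(Real.log n) : ℝ) * Complex.I) - 1‖ ≤ 1
    · obtain ⟨r, hr⟩ := exists_prod_one_add_div_eq_exp h (n - 1)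
      exact ⟨r, fun _ => hr⟩
    · exact ⟨0, fun h' => absurd h' h⟩
  choose r hr using hr
  have hr0 : Tendsto r atTop (𝓝 0) := by
    refine squeeze_zero_norm' (hw1.mono fun n hn => (hr n hn).1) ?_
    simpa using hw.norm.pow 2
  have hH : Tendsto (fun n : ℕ => (Complex.exp ((t / √(Real.log n) : ℝ) * Complex.I) - 1) *
      ((harmonic n - Real.log n - 1 : ℝ) : ℂ)) atTop (𝓝 0) := by
    have h := (Complex.continuous_ofReal.tendsto _).comp (Real.tendsto_harmonic_sub_log.sub_const 1)
    simpa using hw.mul h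
  -- With `s = t / √(log n)`, the cubic Taylor remainder times `log n` is of order `t² |s|`, because
  -- `s² log n = t²`.
  have hT : Tendsto (fun n : ℕ => (Complex.exp ((t / √(Real.log n) : ℝ) * Complex.I) - 1 -
      (t / √(Real.log n) : ℝ) * Complex.I + ((t / √(Real.log n) : ℝ) : ℂ) ^ 2 / 2) *
        (Real.log n : ℂ)) atTop (𝓝 0) := by
    refine squeeze_zero_norm' (a := fun n : ℕ => t ^ 2 * |t / √(Real.log n)| *
      Real.exp |t / √(Real.log n)|) ?_ ?_
    · filter_upwards [hL.eventually_gt_atTop 0] with n hn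
      rw [norm_mul, Complex.norm_real, Real.norm_of_nonneg hn.le]
      refine (mul_le_mul_of_nonneg_right (norm_exp_mul_I_sub_le _) hn.le).trans_eq ?_
      have h2 : |t / √(Real.log n)| ^ 2 * Real.log n = t ^ 2 := by
        rw [sq_abs, div_pow, Real.sq_sqrt hn.le, div_mul_cancel₀ _ hn.ne']
      rw [← h2]
      ring
    · simpa using (hs'.const_mul (t ^ 2)).mul ((Real.continuous_exp.tendsto 0).comp hs')
  have hA : Tendsto (fun n : ℕ =>
      Complex.exp (-((t / √(Real.log n) * Real.log n : ℝ) * Complex.I)) *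
      ((1 - Complex.exp ((t / √(Real.log n) : ℝ) * Complex.I)) / n)) atTop (𝓝 0) := by
    refine squeeze_zero_norm (a := fun n : ℕ =>
      ‖Complex.exp ((t / √(Real.log n) : ℝ) * Complex.I) - 1‖) (fun n => ?_) (by simpa using hw.norm)
    rw [norm_mul, ← neg_mul, ← Complex.ofReal_neg, Complex.norm_exp_ofReal_mul_I, one_mul, norm_div,
      norm_sub_rev, Complex.norm_natCast]
    rcases n.eq_zero_or_pos with rfl | hn
    · simp
    · exact div_le_self (norm_nonneg _) (by exact_mod_cast hn)
  have hB := hz.mul ((Complex.continuous_exp.tendsto _).comp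
    (((hH.add hr0).add hT).add_const (-(t ^ 2 / 2 : ℂ))))
  have hAB := hA.add hB
  simp only [zero_add, one_mul] at hAB
  refine hAB.congr' ?_
  filter_upwards [hw1, hL.eventually_gt_atTop 0, eventually_ge_atTop 1] with n hn hLn h1
  have hsq : ((t / √(Real.log n) : ℝ) : ℂ) ^ 2 * (Real.log n : ℂ) = t ^ 2 := by
    have : (t / √(Real.log n)) ^ 2 * Real.log n = t ^ 2 := by
      rw [div_pow, Real.sq_sqrt hLn.le, div_mul_cancel₀ _ hLn.ne']
    exact_mod_cast this
  rw [(hr n hn).2, Nat.sub_add_cancel h1, mul_add, mul_left_comm, ← Complex.exp_add]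
  simp only [Function.comp_apply]
  congr 3
  -- The centring cancels the linear term `i s log n`; the quadratic term is the constant `-t² / 2`.
  rw [← hsq]
  push_cast
  ring

theorem charFun_map_misplaced {Ω : Type*} [MeasurableSpace Ω] {P : Measure Ω} {n : ℕ}
    (hn : 1 ≤ n) {N : Ω → (Fin n → Fin n)} (hN : HasLaw N (placementLaw n).toMeasure P)
    (c d t : ℝ) :
    charFun (P.map fun ω => ((misplaced (N ω) : ℝ) - c) / d) t =
      Complex.exp (-((t / d * c : ℝ) * Complex.I)) *
      ((1 - Complex.exp ((t / d : ℝ) * Complex.I)) / n +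
        Complex.exp ((t / d : ℝ) * Complex.I) * ∏ j ∈ Finset.range (n - 1),
          (1 + (Complex.exp ((t / d : ℝ) * Complex.I) - 1) / (j + 2))) := by
  have hm : Measurable fun M : Fin n → Fin n => ((misplaced M : ℝ) - c) / d :=
    measurable_of_finite _
  have hmap : (P.map fun ω => ((misplaced (N ω) : ℝ) - c) / d) =
      (placementLaw n).toMeasure.map fun M => ((misplaced M : ℝ) - c) / d := by
    rw [← hN.map_eq, AEMeasurable.map_map_of_aemeasurable hm.aemeasurable hN.aemeasurable]
    rfl
  rw [hmap, charFun_apply_real, integral_map hm.aemeasurable (by fun_prop), PMF.integral_eq_sum,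
    ← pmfMean_pow_misplaced _ hn, pmfMean, Finset.mul_sum]
  refine Finset.sum_congr rfl fun M _ => ?_
  rw [Complex.real_smul, mul_left_comm, ← Complex.exp_nat_mul, ← Complex.exp_add]
  congr 2
  push_cast
  ring

end BallsInPits

theorem mainTheorem3 {Ω : ℕ → Type*} [∀ n, MeasurableSpace (Ω n)]
    (P : ∀ n, Measure (Ω n)) [∀ n, IsProbabilityMeasure (P n)]
    (N : ∀ n, Ω n → (Fin n → Fin n))
    (hN : ∀ n, HasLaw (N n) (BallsInPits.placementLaw n).toMeasure (P n))
    {Ω' : Type*} [MeasurableSpace Ω'] (P' : Measure Ω') [IsProbabilityMeasure P']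
    (Z : Ω' → ℝ) (hZ : HasLaw Z (gaussianReal 0 1) P') :
    TendstoInDistribution
      (fun n ω => ((BallsInPits.misplaced (N n ω) : ℝ) - Real.log n) / √(Real.log n))
      atTop Z P P' where
  forall_aemeasurable n := (measurable_of_finite fun M : Fin n → Fin n =>
    ((BallsInPits.misplaced M : ℝ) - Real.log n) / √(Real.log n)).comp_aemeasurable
      (hN n).aemeasurable
  aemeasurable_limit := hZ.aemeasurable
  tendsto := by
    refine ProbabilityMeasure.tendsto_iff_tendsto_charFun.2 fun t => ?_
    have hG : charFun (P'.map Z) t = Complex.exp (-(t ^ 2 / 2)) := by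
      rw [hZ.map_eq, charFun_gaussianReal]
      simp
    simp only [ProbabilityMeasure.coe_mk, hG]
    refine (BallsInPits.tendsto_exp_mul_prod_exp t).congr' ?_
    filter_upwards [eventually_ge_atTop 1] with n hn
    exact (BallsInPits.charFun_map_misplaced hn (hN n) _ _ t).symm
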